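/- Call an entire function $f$ of order of growth $<1$ if there are $\rho\in(0,1)$ and $A,B>0$ with $|f(z)|\le A e^{B|z|^{\rho}}$ for all $z\in\mathbb C$, and let $\mathcal M_{<1}$ be the field of all quotients $g/h$ of such functions ($h\not\equiv 0$), a subfield of the field $\mathcal M$ of meromorphic functions on $\mathbb C$ (the quotient field of the ring of entire functions). Let $\varphi\in\mathcal M_{<1}$ be a non-constant function, let $P_1,\dots,P_r\in\mathbb C[z]$ be non-constant polynomials of degrees $d_1,\dots,d_r$ such that $P_j-P_k$ is non-constant for all $j\ne k$, and let $f_j(z)=e^{P_j(z)}$ for $1\le j\le r$. Then: (1) $\varphi,f_1,\dots,f_r$ are linearly independent over $\mathbb C$. (2) If $d_1,\dots,d_r$ are pairwise distinct, then $\varphi,f_1,\dots,f_r$ are algebraically independent over $\mathbb C$. Moreover, let $A=(a_{ij})_{0\le i,j\le r}$ be a nonsingular matrix with entries in $\mathbb C$, and put $$g_j=a_{0j}\varphi+a_{1j}f_1+\cdots+a_{rj}f_r\qquad(0\le j\le r).$$ Then conclusions (1) and (2) also hold with $\varphi,f_1,\dots,f_r$ replaced by $g_0,g_1,\dots,g_r$.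 -/

import Mathlib

open scoped ENNReal

noncomputable section

/-- The `ℂ`-algebra `𝒪` of entire functions, with pointwise operations. -/
def EntireAlgebra : Subalgebra ℂ (ℂ → ℂ) where
  carrier := {f | Differentiable ℂ f}
  mul_mem' hf hg := Differentiable.mul hf hg
  add_mem' hf hg := Differentiable.add hf hg
  algebraMap_mem' c := differentiable_const c

instance : IsDomain EntireAlgebra :=
  haveI : NoZeroDivisors EntireAlgebra := ⟨by
    rintro ⟨f, hf⟩ ⟨g, hg⟩ h
    have hfg : ∀ z ∈ (Set.univ : Set ℂ), f z * g z = 0 := fun z _ =>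
      congrFun (congrArg Subtype.val h) z
    have hf' : Differentiable ℂ f := hf
    have hg' : Differentiable ℂ g := hg
    rcases AnalyticOnNhd.eq_zero_or_eq_zero_of_mul_eq_zero
      (fun z _ => hf'.analyticAt z) (fun z _ => hg'.analyticAt z) hfg
      isPreconnected_univ with h0 | h0
    · exact Or.inl (Subtype.ext (funext fun z => h0 z trivial))
    · exact Or.inr (Subtype.ext (funext fun z => h0 z trivial))⟩
  NoZeroDivisors.to_isDomain _

/-- The field `𝓜` of meromorphic functions on `ℂ`: the quotient field of `𝒪`. -/
abbrev MeromorphicField : Type := FractionRing EntireAlgebra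

/-- `f` has order of growth `≤ ρ`: `|f(z)| ≤ A e^{B |z|^ρ}` for some constants `A, B > 0`. -/
def HasGrowthLE (f : ℂ → ℂ) (ρ : ℝ) : Prop :=
  ∃ A B : ℝ, 0 < A ∧ 0 < B ∧ ∀ z : ℂ, ‖f z‖ ≤ A * Real.exp (B * ‖z‖ ^ ρ)

/-- The order of growth `ρ(f) = inf {ρ > 0 : f has order of growth ≤ ρ}`, which is `∞` when
there is no such `ρ`. -/
def growthOrder (f : ℂ → ℂ) : ℝ≥0∞ :=
  sInf {x | ∃ ρ : ℝ, 0 < ρ ∧ HasGrowthLE f ρ ∧ x = ENNReal.ofReal ρ}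

theorem growthOrder_lt_one_iff {f : ℂ → ℂ} :
    growthOrder f < 1 ↔ ∃ ρ : ℝ, 0 < ρ ∧ ρ < 1 ∧ HasGrowthLE f ρ := by
  unfold growthOrder
  rw [sInf_lt_iff]
  constructor
  · rintro ⟨x, ⟨ρ, h0, h, rfl⟩, hx⟩
    exact ⟨ρ, h0, by simpa using hx, h⟩
  · rintro ⟨ρ, h0, h1, h⟩
    exact ⟨_, ⟨ρ, h0, h, rfl⟩, by simpa using h1⟩

theorem HasGrowthLE.mono {f : ℂ → ℂ} {ρ σ : ℝ} (h0 : 0 < ρ) (hρσ : ρ ≤ σ)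
    (h : HasGrowthLE f ρ) : HasGrowthLE f σ := by
  obtain ⟨A, B, hA, hB, h⟩ := h
  refine ⟨A * Real.exp B, B, by positivity, hB, fun z => (h z).trans ?_⟩
  rw [mul_assoc, ← Real.exp_add]
  have key : ‖z‖ ^ ρ ≤ 1 + ‖z‖ ^ σ := by
    rcases le_total ‖z‖ 1 with hz | hz
    · have := Real.rpow_le_one (norm_nonneg z) hz h0.le
      have := Real.rpow_nonneg (norm_nonneg z) σ
      linarith
    · have := Real.rpow_le_rpow_of_exponent_le hz hρσ
      linarith
  have := mul_le_mul_of_nonneg_left key hB.le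
  gcongr
  linarith

theorem HasGrowthLE.add {f g : ℂ → ℂ} {ρ : ℝ} (hf : HasGrowthLE f ρ) (hg : HasGrowthLE g ρ) :
    HasGrowthLE (f + g) ρ := by
  obtain ⟨A, B, hA, hB, h⟩ := hf
  obtain ⟨A', B', hA', hB', h'⟩ := hg
  refine ⟨A + A', B + B', by positivity, by positivity, fun z => ?_⟩
  have hz := Real.rpow_nonneg (norm_nonneg z) ρ
  calc ‖(f + g) z‖ ≤ ‖f z‖ + ‖g z‖ := norm_add_le _ _
    _ ≤ A * Real.exp (B * ‖z‖ ^ ρ) + A' * Real.exp (B' * ‖z‖ ^ ρ) := add_le_add (h z) (h' z)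
    _ ≤ A * Real.exp ((B + B') * ‖z‖ ^ ρ) + A' * Real.exp ((B + B') * ‖z‖ ^ ρ) := by
        gcongr <;> linarith
    _ = _ := by ring

theorem HasGrowthLE.mul {f g : ℂ → ℂ} {ρ : ℝ} (hf : HasGrowthLE f ρ) (hg : HasGrowthLE g ρ) :
    HasGrowthLE (f * g) ρ := by
  obtain ⟨A, B, hA, hB, h⟩ := hf
  obtain ⟨A', B', hA', hB', h'⟩ := hg
  refine ⟨A * A', B + B', by positivity, by positivity, fun z => ?_⟩
  calc ‖(f * g) z‖ = ‖f z‖ * ‖g z‖ := norm_mul _ _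
    _ ≤ (A * Real.exp (B * ‖z‖ ^ ρ)) * (A' * Real.exp (B' * ‖z‖ ^ ρ)) :=
        mul_le_mul (h z) (h' z) (norm_nonneg _) (by positivity)
    _ = _ := by rw [add_mul, Real.exp_add]; ring

theorem growthOrder_lt_one_common {f g : ℂ → ℂ} (hf : growthOrder f < 1)
    (hg : growthOrder g < 1) :
    ∃ ρ : ℝ, 0 < ρ ∧ ρ < 1 ∧ HasGrowthLE f ρ ∧ HasGrowthLE g ρ := by
  obtain ⟨ρ, h0, h1, h⟩ := growthOrder_lt_one_iff.1 hf
  obtain ⟨σ, k0, k1, k⟩ := growthOrder_lt_one_iff.1 hg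
  exact ⟨max ρ σ, lt_max_of_lt_left h0, max_lt h1 k1, h.mono h0 (le_max_left _ _),
    k.mono k0 (le_max_right _ _)⟩

/-- The `ℂ`-algebra `𝒪_{<1}` of entire functions with order of growth `< 1`. -/
def EntireOrderLTOne : Subalgebra ℂ EntireAlgebra where
  carrier := {f | growthOrder f.1 < 1}
  mul_mem' {f g} hf hg := by
    obtain ⟨ρ, h0, h1, h, h'⟩ := growthOrder_lt_one_common hf hg
    exact growthOrder_lt_one_iff.2 ⟨ρ, h0, h1, h.mul h'⟩
  add_mem' {f g} hf hg := by
    obtain ⟨ρ, h0, h1, h, h'⟩ := growthOrder_lt_one_common hf hg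
    exact growthOrder_lt_one_iff.2 ⟨ρ, h0, h1, h.add h'⟩
  algebraMap_mem' c := by
    refine growthOrder_lt_one_iff.2 ⟨1 / 2, by norm_num, by norm_num, ‖c‖ + 1, 1,
      by positivity, one_pos, fun z => ?_⟩
    have h1 : (1 : ℝ) ≤ Real.exp (1 * ‖z‖ ^ (1 / 2 : ℝ)) := Real.one_le_exp (by positivity)
    change ‖c‖ ≤ _
    nlinarith [norm_nonneg c]

/-- The field `𝓜_{<1}` of meromorphic functions of order `< 1`: the quotient field of
`𝒪_{<1}`, realised inside `𝓜` as the set of quotients `g / h`. -/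
def MeromorphicOrderLTOne : IntermediateField ℂ MeromorphicField where
  carrier := {φ | ∃ g ∈ EntireOrderLTOne, ∃ h ∈ EntireOrderLTOne, h ≠ 0 ∧
    φ = algebraMap EntireAlgebra MeromorphicField g / algebraMap EntireAlgebra MeromorphicField h}
  mul_mem' := by
    rintro _ _ ⟨g, hg, h, hh, h0, rfl⟩ ⟨g', hg', h', hh', h0', rfl⟩
    refine ⟨g * g', mul_mem hg hg', h * h', mul_mem hh hh', mul_ne_zero h0 h0', ?_⟩
    rw [map_mul, map_mul, div_mul_div_comm]
  add_mem' := by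
    rintro _ _ ⟨g, hg, h, hh, h0, rfl⟩ ⟨g', hg', h', hh', h0', rfl⟩
    refine ⟨g * h' + h * g', add_mem (mul_mem hg hh') (mul_mem hh hg'), h * h',
      mul_mem hh hh', mul_ne_zero h0 h0', ?_⟩
    have e : algebraMap EntireAlgebra MeromorphicField h ≠ 0 := fun H =>
      h0 ((map_eq_zero_iff _ (IsFractionRing.injective EntireAlgebra MeromorphicField)).1 H)
    have e' : algebraMap EntireAlgebra MeromorphicField h' ≠ 0 := fun H =>
      h0' ((map_eq_zero_iff _ (IsFractionRing.injective EntireAlgebra MeromorphicField)).1 H)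
    rw [map_add, map_mul, map_mul, map_mul, div_add_div _ _ e e']
  algebraMap_mem' c := by
    refine ⟨algebraMap ℂ EntireAlgebra c, algebraMap_mem _ c, 1, one_mem _, one_ne_zero, ?_⟩
    rw [map_one, div_one, ← IsScalarTower.algebraMap_apply]
  inv_mem' := by
    rintro _ ⟨g, hg, h, hh, h0, rfl⟩
    rcases eq_or_ne g 0 with rfl | hg0
    · exact ⟨0, zero_mem _, 1, one_mem _, one_ne_zero, by simp⟩
    · exact ⟨h, hh, g, hg, hg0, by rw [inv_div]⟩

/-- The entire function `z ↦ e^{P(z)}`. -/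
def expPoly (P : Polynomial ℂ) : EntireAlgebra :=
  ⟨fun z => Complex.exp (P.eval z), P.differentiable.cexp⟩

/-- The family `φ, e^{P_1}, …, e^{P_r}` of meromorphic functions, indexed by `0, 1, …, r`. -/
def expFamily {r : ℕ} (φ : MeromorphicField) (P : Fin r → Polynomial ℂ) :
    Fin (r + 1) → MeromorphicField :=
  Fin.cons φ fun j => algebraMap EntireAlgebra MeromorphicField (expPoly (P j))

end

/-! The core is a theorem of Borel type: exponentials of polynomials with non-constant differences
are linearly independent over `MeromorphicOrderLTOne`. In a relation between them, differentiating
and eliminating one term gives a shorter relation; by induction its coefficients vanish, which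
forces some `e^R`, with `R = Q j - Q i`, to be a quotient of entire functions of order `< 1`. That
is impossible (`deriv_eq_zero_of_mul_exp_eq`): Jensen's inequality bounds the circle averages of
`|Re R|` by `O(r^ρ)` with `ρ < 1`, and such an average divided by `r` controls `R'` at the centre,
so `R' = 0`.

Conclusion (1) applies this to the exponents `0, P_1, …, P_r` and rescales `e^0 = 1` to `φ`. For
(2), monomials in the `e^{P_j}` are again exponentials of polynomials, and distinct degrees keep
their exponents apart; so the `e^{P_j}` are algebraically independent over a field containing `φ`,
which is itself transcendental over `ℂ`. An invertible linear substitution preserves both kinds of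
independence. -/

/-! ### Circle averages and quotients of order `< 1` -/

open Real Metric Filter Topology in
theorem norm_circleAverage_le (f : ℂ → ℂ) (c : ℂ) (R : ℝ) :
    ‖circleAverage f c R‖ ≤ circleAverage (fun z => ‖f z‖) c R := by
  have hpi : (0 : ℝ) ≤ 2 * π := by positivity
  simp only [circleAverage, norm_smul, smul_eq_mul]
  rw [Real.norm_of_nonneg (by positivity)]
  gcongr
  exact intervalIntegral.norm_integral_le_integral_norm hpi

open Real Metric Filter Topology in
/-- The first Fourier coefficient of the real part of an entire function on a circle recovers the
derivative at the centre. -/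
theorem deriv_eq_circleAverage_re {f : ℂ → ℂ} (hf : Differentiable ℂ f) (c : ℂ)
    {r : ℝ} (hr : 0 < r) :
    deriv f c = circleAverage (fun z => (2 * (f z).re : ℂ) * (z - c)⁻¹) c r := by
  have hne : ∀ z ∈ sphere c r, z - c ≠ 0 := fun z hz h => by
    have : dist z c = r := hz
    rw [dist_eq_norm, h, norm_zero] at this
    exact hr.ne this
  have hinv : ContinuousOn (fun z : ℂ => (z - c)⁻¹) (sphere c r) :=
    (by fun_prop : Continuous fun z : ℂ => z - c).continuousOn.inv₀ hne
  have h1 : circleAverage (fun z => f z * (z - c)⁻¹) c r = deriv f c := by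
    rw [circleAverage_eq_circleIntegral hr.ne',
      ← Complex.two_pi_I_inv_smul_circleIntegral_sub_sq_inv_smul_of_differentiable isOpen_univ
        (Set.subset_univ (closedBall c r)) hf.differentiableOn (mem_ball_self hr)]
    congr 2
    ext z
    simp only [smul_eq_mul, ← inv_pow]
    ring
  -- On the circle `(z - c)⁻¹ = conj (z - c) / r²`, so the integrand is the conjugate of an entire
  -- function vanishing at `c`.
  have h2 : circleAverage (fun z => (starRingEnd ℂ) (f z) * (z - c)⁻¹) c r = 0 := by
    have h3 : circleAverage (fun z => ((r : ℂ) ^ 2)⁻¹ * (f z * (z - c))) c r = 0 := by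
      have := DiffContOnCl.circleAverage (f := fun z => ((r : ℂ) ^ 2)⁻¹ * (f z * (z - c)))
        (c := c) (R := r)
        (Differentiable.diffContOnCl (by fun_prop))
      simpa using this
    have h4 := (Complex.conjCLE : ℂ →L[ℝ] ℂ).circleAverage_comp_comm
      (f := fun z => ((r : ℂ) ^ 2)⁻¹ * (f z * (z - c))) (c := c) (R := r)
      (ContinuousOn.circleIntegrable hr.le
        (Differentiable.continuous (𝕜 := ℂ) (by fun_prop)).continuousOn)
    rw [h3, map_zero] at h4
    rw [← h4]
    refine circleAverage_congr_sphere fun z hz => ?_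
    rw [abs_of_pos hr] at hz
    have hz' : ‖z - c‖ = r := by simpa [dist_eq_norm] using hz
    have hn := Complex.mul_conj' (z - c)
    rw [hz'] at hn
    have hr' : (r : ℂ) ≠ 0 := by exact_mod_cast hr.ne'
    simp only [Function.comp, ContinuousLinearEquiv.coe_coe, Complex.conjCLE_apply, map_mul,
      map_inv₀, map_pow, Complex.conj_ofReal]
    rw [← hn]
    have hz0 : (starRingEnd ℂ) (z - c) ≠ 0 := (map_ne_zero _).2 (hne z hz)
    field_simp [hne z hz]
  have hint : ∀ F : ℂ → ℂ, Continuous F → CircleIntegrable (fun z => F z * (z - c)⁻¹) c r :=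
    fun F hF => (hF.continuousOn.mul hinv).circleIntegrable hr.le
  have hconj : CircleIntegrable (fun z => (starRingEnd ℂ) (f z) * (z - c)⁻¹) c r :=
    hint _ (Complex.continuous_conj.comp hf.continuous)
  rw [← h1, ← add_zero (circleAverage (fun z => f z * (z - c)⁻¹) c r), ← h2,
    ← circleAverage_add (hint _ hf.continuous) hconj]
  congr 1
  ext z
  simp only [Pi.add_apply, ← add_mul, Complex.add_conj]
  push_cast
  rfl

open Real Metric Filter Topology in
theorem norm_deriv_le_circleAverage_abs_re {f : ℂ → ℂ} (hf : Differentiable ℂ f)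
    (c : ℂ) {r : ℝ} (hr : 0 < r) :
    ‖deriv f c‖ ≤ 2 / r * circleAverage (fun z => |(f z).re|) c r := by
  rw [deriv_eq_circleAverage_re hf c hr, ← smul_eq_mul, ← circleAverage_fun_smul]
  refine (norm_circleAverage_le _ _ _).trans_eq (circleAverage_congr_sphere fun z hz => ?_)
  have hz' : ‖z - c‖ = r := by simpa [dist_eq_norm, abs_of_pos hr] using hz
  simp only [norm_mul, norm_inv, hz', Complex.norm_real, smul_eq_mul, Complex.norm_ofNat,
    Real.norm_eq_abs]
  ring

open Real Metric Filter Topology in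
/-- Jensen's inequality. -/
theorem log_norm_le_circleAverage_log_norm {g : ℂ → ℂ} (hg : Differentiable ℂ g) {c : ℂ}
    (hc : g c ≠ 0) {r : ℝ} (hr : 0 < r) :
    log ‖g c‖ ≤ circleAverage (fun z => log ‖g z‖) c r := by
  have hA : AnalyticOnNhd ℂ g (closedBall c |r|) := fun z _ => hg.analyticAt z
  rw [AnalyticOnNhd.circleAverage_log_norm hr.ne' hA hc]
  refine le_add_of_nonneg_left (finsum_nonneg fun u => ?_)
  by_cases hu : u ∈ closedBall c |r|
  · refine mul_nonneg (by exact_mod_cast MeromorphicOn.AnalyticOnNhd.divisor_nonneg hA u) ?_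
    rcases eq_or_ne u c with rfl | huc
    · simp
    have hu' : ‖c - u‖ ≤ r := by simpa [dist_eq_norm, abs_of_pos hr, norm_sub_rev] using hu
    have : 0 < ‖c - u‖ := norm_pos_iff.2 (sub_ne_zero.2 huc.symm)
    apply log_nonneg
    rw [← div_eq_mul_inv, one_le_div this]
    exact hu'
  · rw [Function.locallyFinsuppWithin.apply_eq_zero_of_notMem _ hu]
    simp

-- Write `|Re f| = 2 (Re f)⁺ - Re f`. Off the zeros of `g`, `Re f = log ‖h‖ - log ‖g‖`, so `(Re f)⁺
-- ≤ M + N - log ‖g‖`. Averaging uses the mean value property for `Re f` and Jensen for `log ‖g‖`.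
open Real Metric Filter Topology in
theorem circleAverage_abs_re_le {f g h : ℂ → ℂ} (hf : Differentiable ℂ f)
    (hg : Differentiable ℂ g)
    (hgh : ∀ z, g z * Complex.exp (f z) = h z) {c : ℂ} (hc : g c ≠ 0) {r M N : ℝ} (hr : 0 < r)
    (hM : ∀ z ∈ sphere c r, log⁺ ‖g z‖ ≤ M) (hN : ∀ z ∈ sphere c r, log⁺ ‖h z‖ ≤ N) :
    circleAverage (fun z => |(f z).re|) c r ≤ 2 * (M + N - log ‖g c‖) - (f c).re := by
  classical
  have hcod : {z | g z ≠ 0} ∈ codiscreteWithin (sphere c |r|) := by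
    refine codiscreteWithin_mono (Set.subset_univ _) ?_
    exact AnalyticOnNhd.preimage_zero_mem_codiscreteWithin (fun z _ => hg.analyticAt z) hc
      (Set.mem_univ c) isConnected_univ
  have hre : Continuous fun z => (f z).re := Complex.continuous_re.comp hf.continuous
  have hreI : CircleIntegrable (fun z => (f z).re) c r := hre.continuousOn.circleIntegrable hr.le
  have hlogI : CircleIntegrable (fun z => log ‖g z‖) c r :=
    MeromorphicOn.circleIntegrable_log_norm fun z _ => (hg.analyticAt z).meromorphicAt
  -- Since `log 0 = 0`, the pointwise bound can fail at zeros of `g`; changing the integrand on this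
  -- discrete set restores it and leaves the average alone.
  have heq : (fun z => |(f z).re|) =ᶠ[codiscreteWithin (sphere c |r|)]
      fun z => if g z = 0 then -(f z).re else |(f z).re| := by
    filter_upwards [hcod] with z hz
    rw [if_neg hz]
  rw [circleAverage_congr_codiscreteWithin heq hr.ne']
  have hI2 : CircleIntegrable (fun z => 2 * (M + N - log ‖g z‖) - (f z).re) c r := by
    have := (((circleIntegrable_const (M + N) c r).sub hlogI).const_smul (a := (2 : ℝ))).sub hreI
    exact this
  have hav : circleAverage (fun z => (f z).re) c r = (f c).re := by
    have h1 := Complex.reCLM.circleAverage_comp_comm (c := c) (R := r)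
      (hf.continuous.continuousOn.circleIntegrable hr.le)
    rw [DiffContOnCl.circleAverage hf.diffContOnCl] at h1
    exact h1
  calc _ ≤ circleAverage (fun z => 2 * (M + N - log ‖g z‖) - (f z).re) c r := by
        refine circleAverage_mono ?_ hI2 fun z hz => ?_
        · exact (hre.abs.continuousOn.circleIntegrable hr.le).congr_codiscreteWithin heq
        · rw [abs_of_pos hr] at hz
          have h1 := hM z hz
          have h2 := hN z hz
          have h3 : 0 ≤ log⁺ ‖g z‖ := posLog_nonneg
          have h4 : 0 ≤ log⁺ ‖h z‖ := posLog_nonneg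
          split_ifs with hz0
          · rw [hz0, norm_zero, log_zero]
            linarith
          · have h5 : log ‖h z‖ = log ‖g z‖ + (f z).re := by
              rw [← hgh z, norm_mul, Complex.norm_exp,
                log_mul (norm_ne_zero_iff.2 hz0) (exp_pos _).ne', log_exp]
            have h6 : log ‖g z‖ ≤ log⁺ ‖g z‖ := le_max_right _ _
            have h7 : log ‖h z‖ ≤ log⁺ ‖h z‖ := le_max_right _ _
            rcases abs_cases (f z).re with ⟨h8, _⟩ | ⟨h8, _⟩ <;> rw [h8] <;> linarith
    _ = 2 * (M + N - circleAverage (fun z => log ‖g z‖) c r) - (f c).re := by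
        have e1 : (fun z => 2 * (M + N - log ‖g z‖) - (f z).re)
            = (2 : ℝ) • ((fun _ => M + N) - fun z => log ‖g z‖) - fun z => (f z).re := by
          ext z; simp
        rw [e1, circleAverage_sub _ hreI, circleAverage_smul,
          circleAverage_sub (circleIntegrable_const _ _ _) hlogI, circleAverage_const, hav,
          smul_eq_mul]
        exact ((circleIntegrable_const (M + N) c r).sub hlogI).const_smul
    _ ≤ _ := by
        have := log_norm_le_circleAverage_log_norm hg hc hr
        linarith

open Real Metric Filter Topology in
theorem HasGrowthLE.posLog_norm_le {f : ℂ → ℂ} {ρ : ℝ} (hρ : 0 < ρ) (h : HasGrowthLE f ρ) (c : ℂ) :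
    ∃ C D : ℝ, ∀ r, 0 < r → ∀ z ∈ sphere c r, log⁺ ‖f z‖ ≤ C + D * (‖c‖ + r) ^ ρ := by
  obtain ⟨A, B, hA, hB, h⟩ := h
  refine ⟨log⁺ A, B, fun r hr z hz => ?_⟩
  have hz' : ‖z‖ ≤ ‖c‖ + r := by
    have h1 : ‖z - c‖ = r := by simpa [dist_eq_norm] using hz
    have := norm_add_le (z - c) c
    rw [sub_add_cancel, h1] at this
    linarith
  have h2 : ‖z‖ ^ ρ ≤ (‖c‖ + r) ^ ρ := rpow_le_rpow (norm_nonneg z) hz' hρ.le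
  calc log⁺ ‖f z‖ ≤ log⁺ (A * exp (B * ‖z‖ ^ ρ)) := posLog_le_posLog (norm_nonneg _) (h z)
    _ ≤ log⁺ A + log⁺ (exp (B * ‖z‖ ^ ρ)) := posLog_mul
    _ ≤ log⁺ A + B * (‖c‖ + r) ^ ρ := by
        have h3 : 0 ≤ B * ‖z‖ ^ ρ := by positivity
        rw [posLog_apply (x := exp _), log_exp, max_eq_right h3]
        gcongr

open Real Metric Filter Topology in
/-- If `e^f` is a quotient of entire functions of order `< 1`, then `f` is locally constant off
the zeros of the denominator. -/
theorem deriv_eq_zero_of_mul_exp_eq {f g h : ℂ → ℂ} (hf : Differentiable ℂ f)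
    (hg : Differentiable ℂ g) (hg1 : growthOrder g < 1)
    (hh1 : growthOrder h < 1) (hgh : ∀ z, g z * Complex.exp (f z) = h z) {c : ℂ} (hc : g c ≠ 0) :
    deriv f c = 0 := by
  obtain ⟨ρ, h0, h1, hgρ, hhρ⟩ := growthOrder_lt_one_common hg1 hh1
  obtain ⟨C, D, hCD⟩ := hgρ.posLog_norm_le h0 c
  obtain ⟨C', D', hCD'⟩ := hhρ.posLog_norm_le h0 c
  set K : ℝ := 2 * (2 * (C + C' - log ‖g c‖) - (f c).re) with hK
  set L : ℝ := 4 * (D + D') with hL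
  have hbound : ∀ r, 0 < r → ‖deriv f c‖ ≤ K * r⁻¹ + L * ((‖c‖ + r) ^ ρ * r⁻¹) := by
    intro r hr
    have h2 := norm_deriv_le_circleAverage_abs_re hf c hr
    have h3 := circleAverage_abs_re_le hf hg hgh hc hr (hCD r hr) (hCD' r hr)
    have h4 : (0 : ℝ) ≤ 2 / r := by positivity
    refine h2.trans ((mul_le_mul_of_nonneg_left h3 h4).trans_eq ?_)
    rw [hK, hL, div_eq_mul_inv]
    ring
  have hlim1 : Tendsto (fun r : ℝ => r⁻¹) atTop (𝓝 0) := tendsto_inv_atTop_zero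
  have hlim2 : Tendsto (fun r : ℝ => (2 : ℝ) ^ ρ * r ^ (-(1 - ρ))) atTop (𝓝 0) := by
    simpa using (tendsto_rpow_neg_atTop (sub_pos.2 h1)).const_mul ((2 : ℝ) ^ ρ)
  have hlim3 : Tendsto (fun r : ℝ => (‖c‖ + r) ^ ρ * r⁻¹) atTop (𝓝 0) := by
    refine tendsto_of_tendsto_of_tendsto_of_le_of_le' tendsto_const_nhds hlim2 ?_ ?_
    · filter_upwards [eventually_gt_atTop 0] with r hr
      positivity
    · filter_upwards [eventually_gt_atTop 0, eventually_ge_atTop ‖c‖] with r hr hr'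
      have : (‖c‖ + r) ^ ρ ≤ (2 * r) ^ ρ :=
        rpow_le_rpow (by positivity) (by linarith) h0.le
      rw [neg_sub, rpow_sub hr, rpow_one, div_eq_mul_inv, ← mul_assoc,
        ← mul_rpow (by norm_num) hr.le]
      gcongr
  have hlim := (hlim1.const_mul K).add (hlim3.const_mul L)
  rw [mul_zero, mul_zero, add_zero] at hlim
  have := ge_of_tendsto hlim (by filter_upwards [eventually_gt_atTop 0] with r hr using hbound r hr)
  exact norm_le_zero_iff.1 this

/-! ### Differentiation and functions of order `< 1` -/

/-- Differentiation of entire functions. -/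
noncomputable def entireDeriv : Derivation ℂ EntireAlgebra EntireAlgebra :=
  Derivation.mk'
    { toFun := fun f => ⟨deriv f.1, fun z =>
        ((show Differentiable ℂ f.1 from f.2).analyticAt z).deriv.differentiableAt⟩
      map_add' := fun f g => Subtype.ext <| funext fun z =>
        deriv_add ((show Differentiable ℂ f.1 from f.2) z) ((show Differentiable ℂ g.1 from g.2) z)
      map_smul' := fun c f => Subtype.ext <| funext fun z =>
        deriv_const_smul c ((show Differentiable ℂ f.1 from f.2) z) }
    fun f g => Subtype.ext <| funext fun z => by
      refine (deriv_mul ((show Differentiable ℂ f.1 from f.2) z)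
        ((show Differentiable ℂ g.1 from g.2) z)).trans ?_
      change _ = f.1 z * deriv g.1 z + g.1 z * deriv f.1 z
      ring

/-- A polynomial as an entire function. -/
noncomputable def polyEntire (Q : Polynomial ℂ) : EntireAlgebra :=
  ⟨fun z => Q.eval z, Q.differentiable⟩

theorem expPoly_zero : expPoly 0 = 1 :=
  Subtype.ext <| funext fun z => by simp [expPoly]

theorem expPoly_add (P Q : Polynomial ℂ) : expPoly (P + Q) = expPoly P * expPoly Q :=
  Subtype.ext <| funext fun z => by
    change Complex.exp ((P + Q).eval z) = Complex.exp (P.eval z) * Complex.exp (Q.eval z)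
    rw [Polynomial.eval_add, Complex.exp_add]

theorem entireDeriv_expPoly (Q : Polynomial ℂ) :
    entireDeriv (expPoly Q) = polyEntire Q.derivative * expPoly Q :=
  Subtype.ext <| funext fun z => by
    change deriv (fun z => Complex.exp (Q.eval z)) z = Q.derivative.eval z * Complex.exp (Q.eval z)
    rw [((Q.hasDerivAt z).cexp).deriv, mul_comm]

theorem polyEntire_mem (Q : Polynomial ℂ) : polyEntire Q ∈ EntireOrderLTOne := by
  have hX : polyEntire Polynomial.X ∈ EntireOrderLTOne := by
    -- With `s = ‖z‖^(1/2)` the bound reads `s² ≤ 2 e^s`.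
    refine growthOrder_lt_one_iff.2 ⟨1 / 2, by norm_num, by norm_num, 2, 1, by norm_num, one_pos,
      fun z => ?_⟩
    change ‖(Polynomial.X : Polynomial ℂ).eval z‖ ≤ _
    rw [Polynomial.eval_X, one_mul]
    have h0 : (0 : ℝ) ≤ ‖z‖ ^ (1 / 2 : ℝ) := by positivity
    have h1 : ‖z‖ = (‖z‖ ^ (1 / 2 : ℝ)) ^ 2 := by
      rw [← Real.rpow_natCast, ← Real.rpow_mul (norm_nonneg z)]
      norm_num
    have h2 := Real.quadratic_le_exp_of_nonneg h0
    nlinarith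
  have hQ : polyEntire Q = Polynomial.aeval (polyEntire Polynomial.X) Q := by
    induction Q using Polynomial.induction_on' with
    | add p q hp hq =>
      rw [map_add, ← hp, ← hq]
      exact Subtype.ext <| funext fun z => Polynomial.eval_add
    | monomial n a =>
      rw [Polynomial.aeval_monomial]
      refine Subtype.ext <| funext fun z => ?_
      change (Polynomial.monomial n a).eval z = a * ((polyEntire Polynomial.X) ^ n).1 z
      rw [Polynomial.eval_monomial, SubmonoidClass.coe_pow, Pi.pow_apply]
      simp [polyEntire]
  rw [hQ, Polynomial.aeval_eq_sum_range]
  exact sum_mem fun i _ => Subalgebra.smul_mem _ (pow_mem hX i) _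

/-- Cauchy's estimate on the unit circle about `z`; subadditivity of `t ↦ t^ρ` for `ρ ≤ 1` costs
only the factor `e^B`. -/
theorem HasGrowthLE.deriv {f : ℂ → ℂ} {ρ : ℝ} (hf : Differentiable ℂ f) (h0 : 0 < ρ) (h1 : ρ ≤ 1)
    (h : HasGrowthLE f ρ) : HasGrowthLE (deriv f) ρ := by
  obtain ⟨A, B, hA, hB, h⟩ := h
  refine ⟨A * Real.exp B, B, by positivity, hB, fun z => ?_⟩
  have hsphere : ∀ w ∈ Metric.sphere z 1, ‖f w‖ ≤ A * Real.exp B * Real.exp (B * ‖z‖ ^ ρ) := by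
    intro w hw
    have hw1 : ‖w - z‖ = 1 := by simpa [dist_eq_norm] using hw
    have hw' : ‖w‖ ≤ ‖z‖ + 1 := by
      have := norm_add_le (w - z) z
      rw [sub_add_cancel, hw1] at this
      linarith
    have h2 : ‖w‖ ^ ρ ≤ ‖z‖ ^ ρ + 1 := by
      refine (Real.rpow_le_rpow (norm_nonneg w) hw' h0.le).trans ?_
      simpa using Real.rpow_add_le_add_rpow (norm_nonneg z) zero_le_one h0.le h1
    refine (h w).trans ?_
    rw [mul_assoc, ← Real.exp_add]
    gcongr
    nlinarith
  simpa using Complex.norm_deriv_le_of_forall_mem_sphere_norm_le one_pos hf.diffContOnCl hsphere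

theorem entireDeriv_mem {f : EntireAlgebra} (hf : f ∈ EntireOrderLTOne) :
    entireDeriv f ∈ EntireOrderLTOne := by
  obtain ⟨ρ, h0, h1, h⟩ := growthOrder_lt_one_iff.1 hf
  exact growthOrder_lt_one_iff.2 ⟨ρ, h0, h1, h.deriv f.2 h0 h1.le⟩

/-- Two entire functions with vanishing Wronskian are proportional. -/
theorem exists_eq_smul_of_entireDeriv_mul_eq {F g : EntireAlgebra} (hg : g ≠ 0)
    (h : entireDeriv F * g = F * entireDeriv g) : ∃ c : ℂ, F = c • g := by
  have hFd : Differentiable ℂ F.1 := F.2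
  have hgd : Differentiable ℂ g.1 := g.2
  obtain ⟨z₀, hz₀⟩ : ∃ z, g.1 z ≠ 0 := by
    by_contra! H
    exact hg (Subtype.ext (funext H))
  obtain ⟨ε, hε, hball⟩ := Metric.isOpen_iff.1
    (isOpen_ne_fun hgd.continuous continuous_const : IsOpen {z | g.1 z ≠ 0}) z₀ hz₀
  have hderiv : ∀ z ∈ Metric.ball z₀ ε, HasDerivAt (fun w => F.1 w / g.1 w) 0 z := fun z hz => by
    have h1 := (hFd z).hasDerivAt.div (hgd z).hasDerivAt (hball hz)
    have h2 : deriv F.1 z * g.1 z = F.1 z * deriv g.1 z := congrFun (congrArg Subtype.val h) z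
    rw [h2, sub_self, zero_div] at h1
    exact h1
  obtain ⟨c, hc⟩ := Metric.isOpen_ball.exists_is_const_of_deriv_eq_zero
    (convex_ball z₀ ε).isPreconnected
    (fun z hz => (hderiv z hz).differentiableAt.differentiableWithinAt)
    (fun z hz => (hderiv z hz).deriv)
  refine ⟨c, Subtype.ext ?_⟩
  refine AnalyticOnNhd.eq_of_eventuallyEq (𝕜 := ℂ) (z₀ := z₀) (fun z _ => hFd.analyticAt z)
    (fun z _ => ((hgd.const_smul c).analyticAt z)) ?_
  filter_upwards [Metric.ball_mem_nhds z₀ hε] with z hz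
  have := hc z hz
  rw [div_eq_iff (hball hz)] at this
  simpa using this

/-- The equation says that `f e^R` and `g` have zero Wronskian, so `f e^R = c g`. Unless `f = 0`,
this makes `R` constant. -/
theorem eq_zero_of_logDeriv_eq {f g : EntireAlgebra} (hf : f ∈ EntireOrderLTOne)
    (hg : g ∈ EntireOrderLTOne) (hg0 : g ≠ 0) {R : Polynomial ℂ} (hR : 1 ≤ R.natDegree)
    (h : g * (entireDeriv f + f * polyEntire R.derivative) = f * entireDeriv g) : f = 0 := by
  obtain ⟨c, hc⟩ := exists_eq_smul_of_entireDeriv_mul_eq (F := f * expPoly R) hg0 (by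
    rw [Derivation.leibniz, entireDeriv_expPoly, smul_eq_mul, smul_eq_mul]
    linear_combination expPoly R * h)
  by_contra hf0
  have key : f * polyEntire R.derivative = 0 := by
    refine Subtype.ext (funext fun z => ?_)
    change f.1 z * R.derivative.eval z = 0
    rcases eq_or_ne (f.1 z) 0 with hz | hz
    · rw [hz, zero_mul]
    · rw [← R.deriv, deriv_eq_zero_of_mul_exp_eq R.differentiable (g := f.1) (h := (c • g).1)
        f.2 hf (Subalgebra.smul_mem _ hg c) (fun w => congrFun (congrArg Subtype.val hc) w)
        hz, mul_zero]
  have h1 : R.derivative = 0 := Polynomial.funext fun z => by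
    have := congrFun (congrArg Subtype.val ((mul_eq_zero.1 key).resolve_left hf0)) z
    simpa [polyEntire] using this
  have := Polynomial.derivative_eq_zero.1 h1
  omega

/-! ### Linear independence of exponentials -/

/-- **Borel's theorem**: exponentials of polynomials with non-constant differences are linearly
independent over the entire functions of order `< 1`. -/
theorem eq_zero_of_sum_mul_expPoly_eq_zero {ι : Type*} (s : Finset ι) (Q : ι → Polynomial ℂ)
    (hQ : ∀ j k, j ≠ k → 1 ≤ (Q j - Q k).natDegree) (a : ι → EntireAlgebra)
    (ha : ∀ j ∈ s, a j ∈ EntireOrderLTOne) (h : ∑ j ∈ s, a j * expPoly (Q j) = 0) :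
    ∀ j ∈ s, a j = 0 := by
  classical
  induction s using Finset.induction_on generalizing a with
  | empty => simp
  | insert i t hit ih =>
    have hai := ha i (Finset.mem_insert_self i t)
    have hat : ∀ j ∈ t, a j ∈ EntireOrderLTOne := fun j hj => ha j (Finset.mem_insert_of_mem hj)
    suffices H : ∀ j ∈ t, a j = 0 by
      rw [Finset.sum_insert hit, Finset.sum_eq_zero fun j hj => by rw [H j hj, zero_mul],
        add_zero, mul_eq_zero] at h
      refine Finset.forall_mem_insert _ _ _ |>.2 ⟨h.resolve_right fun h0 => ?_, H⟩
      exact Complex.exp_ne_zero _ (congrFun (congrArg Subtype.val h0) 0)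
    rcases eq_or_ne (a i) 0 with h0 | h0
    · rw [Finset.sum_insert hit, h0, zero_mul, zero_add] at h
      exact ih a hat h
    set w : ι → EntireAlgebra := fun j => entireDeriv (a j) + a j * polyEntire (Q j).derivative
      with hw
    have hwm : ∀ j ∈ insert i t, w j ∈ EntireOrderLTOne := fun j hj =>
      add_mem (entireDeriv_mem (ha j hj)) (mul_mem (ha j hj) (polyEntire_mem _))
    have hD : ∑ j ∈ insert i t, w j * expPoly (Q j) = 0 := by
      have := congrArg entireDeriv h
      rw [map_sum, map_zero] at this
      rw [← this]
      refine Finset.sum_congr rfl fun j _ => ?_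
      rw [Derivation.leibniz, entireDeriv_expPoly, smul_eq_mul, smul_eq_mul, hw]
      ring
    -- `a i` times the differentiated relation minus `w i` times the original one cancels the `i`-th
    -- term.
    have hb : ∑ j ∈ t, (a i * w j - a j * w i) * expPoly (Q j) = 0 := by
      have h1 : ∑ j ∈ insert i t, (a i * w j - a j * w i) * expPoly (Q j) = 0 := by
        have h2 : ∑ j ∈ insert i t, (a i * w j - a j * w i) * expPoly (Q j)
            = a i * ∑ j ∈ insert i t, w j * expPoly (Q j)
              - w i * ∑ j ∈ insert i t, a j * expPoly (Q j) := by
          rw [Finset.mul_sum, Finset.mul_sum, ← Finset.sum_sub_distrib]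
          exact Finset.sum_congr rfl fun j _ => by ring
        rw [h2, hD, h, mul_zero, mul_zero, sub_zero]
      rwa [Finset.sum_insert hit, mul_comm (a i) (w i), sub_self, zero_mul, zero_add] at h1
    have hb0 := ih _ (fun j hj => sub_mem
      (mul_mem hai (hwm j (Finset.mem_insert_of_mem hj)))
      (mul_mem (hat j hj) (hwm i (Finset.mem_insert_self i t)))) hb
    intro j hj
    have hji : j ≠ i := fun e => hit (e ▸ hj)
    refine eq_zero_of_logDeriv_eq (hat j hj) hai h0 (hQ j i hji) ?_
    have h3 : polyEntire (Q j - Q i).derivative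
        = polyEntire (Q j).derivative - polyEntire (Q i).derivative :=
      Subtype.ext <| funext fun z => by
        change Polynomial.eval z _ = Polynomial.eval z _ - Polynomial.eval z _
        rw [Polynomial.derivative_sub, Polynomial.eval_sub]
    rw [h3]
    have h4 := hb0 j hj
    simp only [hw] at h4
    linear_combination h4

theorem linearIndependent_expPoly {ι : Type*} (Q : ι → Polynomial ℂ)
    (hQ : ∀ j k, j ≠ k → 1 ≤ (Q j - Q k).natDegree) :
    LinearIndependent MeromorphicOrderLTOne
      (fun j => algebraMap EntireAlgebra MeromorphicField (expPoly (Q j))) := by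
  classical
  have hinj := IsFractionRing.injective EntireAlgebra MeromorphicField
  rw [linearIndependent_iff']
  intro s k hk
  choose g hg d hd hd0 hgd using fun j => (k j).2
  have hd0' : ∀ j, algebraMap EntireAlgebra MeromorphicField (d j) ≠ 0 := fun j =>
    (map_ne_zero_iff _ hinj).2 (hd0 j)
  -- Clear denominators.
  have hsum : ∑ j ∈ s, (g j * ∏ i ∈ s.erase j, d i) * expPoly (Q j) = 0 := by
    apply hinj
    rw [map_sum, map_zero, ← mul_zero (algebraMap EntireAlgebra MeromorphicField (∏ i ∈ s, d i)),
      ← hk, Finset.mul_sum]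
    refine Finset.sum_congr rfl fun j hj => ?_
    rw [← Finset.mul_prod_erase s d hj, Algebra.smul_def,
      show algebraMap MeromorphicOrderLTOne MeromorphicField (k j) = _ from hgd j]
    simp only [map_mul]
    field_simp [hd0' j]
  have h0 := eq_zero_of_sum_mul_expPoly_eq_zero s Q hQ _
    (fun j _ => mul_mem (hg j) (prod_mem fun i _ => hd i)) hsum
  intro j hj
  have hgj : g j = 0 :=
    (mul_eq_zero.1 (h0 j hj)).resolve_right (Finset.prod_ne_zero_iff.2 fun i _ => hd0 i)
  refine Subtype.ext ((hgd j).trans ?_)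
  rw [hgj, map_zero, zero_div]
  rfl

/-! ### Algebraic independence -/

/-- Among the terms with `c j ≠ 0`, the one of largest degree has a leading term that nothing
cancels. -/
theorem one_le_natDegree_sum_smul {ι : Type*} [Fintype ι] {P : ι → Polynomial ℂ}
    (hP : ∀ j, 1 ≤ (P j).natDegree) (hinj : Function.Injective fun j => (P j).natDegree)
    {c : ι → ℂ} (hc : c ≠ 0) : 1 ≤ (∑ j, c j • P j).natDegree := by
  classical
  obtain ⟨j₀, hj₀⟩ := Function.ne_iff.1 hc
  obtain ⟨i, hi, hmax⟩ := Finset.exists_max_image (Finset.univ.filter fun j => c j ≠ 0)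
    (fun j => (P j).natDegree) ⟨j₀, by simpa using hj₀⟩
  refine (hP i).trans (Polynomial.le_natDegree_of_ne_zero ?_)
  rw [Polynomial.finsetSum_coeff, Finset.sum_eq_single i]
  · rw [Polynomial.coeff_smul, smul_eq_mul]
    refine mul_ne_zero (by simpa using hi) ?_
    rw [Polynomial.coeff_natDegree, Polynomial.leadingCoeff_ne_zero]
    rintro h
    have := hP i
    simp [h] at this
  · intro j _ hji
    rw [Polynomial.coeff_smul, smul_eq_mul]
    by_cases hcj : c j = 0
    · rw [hcj, zero_mul]
    · rw [Polynomial.coeff_eq_zero_of_natDegree_lt, mul_zero]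
      exact lt_of_le_of_ne (hmax j (by simpa using hcj)) fun e => hji (hinj e)
  · simp

theorem expPoly_sum_nsmul {ι : Type*} (s : Finset ι) (n : ι → ℕ) (P : ι → Polynomial ℂ) :
    expPoly (∑ j ∈ s, n j • P j) = ∏ j ∈ s, expPoly (P j) ^ n j := by
  classical
  have hpow : ∀ (m : ℕ) (Q : Polynomial ℂ), expPoly (m • Q) = expPoly Q ^ m := fun m Q => by
    induction m with
    | zero => rw [zero_smul, pow_zero, expPoly_zero]
    | succ m ih => rw [succ_nsmul, expPoly_add, ih, pow_succ]
  induction s using Finset.induction_on with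
  | empty => simp [expPoly_zero]
  | insert i t hit ih => rw [Finset.sum_insert hit, Finset.prod_insert hit, expPoly_add, hpow, ih]

/-- The monomial with exponent `n` is the exponential of `∑ n j • P j`; distinct `n` give
non-constant differences, so Borel's theorem applies to all monomials at once. -/
theorem algebraicIndependent_expPoly {ι : Type*} [Fintype ι] {P : ι → Polynomial ℂ}
    (hP : ∀ j, 1 ≤ (P j).natDegree) (hinj : Function.Injective fun j => (P j).natDegree) :
    AlgebraicIndependent MeromorphicOrderLTOne
      (fun j => algebraMap EntireAlgebra MeromorphicField (expPoly (P j))) := by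
  have hlin := linearIndependent_expPoly (fun n : ι →₀ ℕ => ∑ j, n j • P j) (fun n m hnm => by
    have hc : (fun j => (n j : ℂ) - m j) ≠ 0 := fun h => hnm <| Finsupp.ext fun j => by
      have := congrFun h j
      exact_mod_cast sub_eq_zero.1 this
    have := one_le_natDegree_sum_smul hP hinj hc
    convert this using 2
    rw [← Finset.sum_sub_distrib]
    refine Finset.sum_congr rfl fun j _ => ?_
    rw [sub_smul, Nat.cast_smul_eq_nsmul, Nat.cast_smul_eq_nsmul])
  rw [algebraicIndependent_iff]
  intro p hp
  rw [MvPolynomial.aeval_def, MvPolynomial.eval₂_eq'] at hp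
  rw [linearIndependent_iff'] at hlin
  have h := hlin p.support (fun n => p.coeff n) (by
    rw [← hp]
    refine Finset.sum_congr rfl fun n _ => ?_
    rw [expPoly_sum_nsmul, map_prod, Algebra.smul_def]
    simp only [map_pow])
  ext n
  by_cases hn : n ∈ p.support
  · rw [h n hn, MvPolynomial.coeff_zero]
  · rw [MvPolynomial.notMem_support_iff.1 hn, MvPolynomial.coeff_zero]

theorem IsAlgClosed.transcendental_of_forall_ne_algebraMap {k L : Type*} [Field k] [IsAlgClosed k]
    [Field L] [Algebra k L] {x : L} (h : ∀ c : k, x ≠ algebraMap k L c) : Transcendental k x := by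
  intro hx
  obtain ⟨c, hc⟩ := minpoly.mem_range_of_degree_eq_one k x
    (IsAlgClosed.degree_eq_one_of_irreducible k (minpoly.irreducible hx.isIntegral))
  exact h c hc.symm

/-- Evaluation at the new family is evaluation at `x` after the linear substitution `Φ A`, which has
left inverse `Φ A⁻¹`. -/
theorem AlgebraicIndependent.sum_smul_of_det_ne_zero {ι k L : Type*} [Fintype ι] [DecidableEq ι]
    [Field k] [CommRing L] [Algebra k L] {x : ι → L} (hx : AlgebraicIndependent k x)
    {A : Matrix ι ι k} (hA : A.det ≠ 0) :
    AlgebraicIndependent k fun j => ∑ i, A i j • x i := by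
  let Φ : Matrix ι ι k → MvPolynomial ι k →ₐ[k] MvPolynomial ι k := fun B =>
    MvPolynomial.aeval fun j => ∑ i, B i j • MvPolynomial.X i
  have hΦ : (Φ A⁻¹).comp (Φ A) = AlgHom.id k _ := by
    refine MvPolynomial.algHom_ext fun j => ?_
    have hinv : A⁻¹ * A = 1 := Matrix.nonsing_inv_mul A (isUnit_iff_ne_zero.2 hA)
    simp only [Φ, AlgHom.comp_apply, MvPolynomial.aeval_X, map_sum, map_smul, Finset.smul_sum,
      AlgHom.id_apply, smul_smul]
    rw [Finset.sum_comm]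
    simp_rw [← Finset.sum_smul]
    have : ∀ l, ∑ i, A i j * A⁻¹ l i = (1 : Matrix ι ι k) l j := fun l => by
      rw [← hinv, Matrix.mul_apply]
      exact Finset.sum_congr rfl fun i _ => mul_comm _ _
    simp_rw [this, Matrix.one_apply, ite_smul, one_smul, zero_smul]
    simp
  have hcomp : MvPolynomial.aeval (fun j => ∑ i, A i j • x i)
      = (MvPolynomial.aeval x : MvPolynomial ι k →ₐ[k] L).comp (Φ A) :=
    MvPolynomial.algHom_ext fun j => by simp [Φ]
  rw [algebraicIndependent_iff_injective_aeval, hcomp, AlgHom.coe_comp]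
  exact Function.Injective.comp hx (Function.LeftInverse.injective (g := Φ A⁻¹) fun p =>
    DFunLike.congr_fun hΦ p)

/-! ### The family with `φ` adjoined -/

theorem linearIndependent_expFamily {r : ℕ} {φ : MeromorphicField} (hφ : φ ∈ MeromorphicOrderLTOne)
    (hφ0 : φ ≠ 0) {P : Fin r → Polynomial ℂ} (hP : ∀ j, 1 ≤ (P j).natDegree)
    (hPP : ∀ j k, j ≠ k → 1 ≤ (P j - P k).natDegree) :
    LinearIndependent ℂ (expFamily φ P) := by
  have h := linearIndependent_expPoly (Fin.cons 0 P : Fin (r + 1) → Polynomial ℂ) (by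
    intro j k hjk
    cases j using Fin.cases <;> cases k using Fin.cases
    · exact absurd rfl hjk
    · simpa using hP _
    · simpa using hP _
    · simpa using hPP _ _ fun e => hjk (congrArg Fin.succ e))
  have hu : (⟨φ, hφ⟩ : MeromorphicOrderLTOne) ≠ 0 := fun e => hφ0 (congrArg Subtype.val e)
  have h2 := (h.units_smul (Fin.cons (Units.mk0 _ hu) fun _ => 1)).restrict_scalars (R := ℂ)
    fun a b hab => (algebraMap ℂ MeromorphicOrderLTOne).injective (by
      simpa only [Algebra.algebraMap_eq_smul_one] using hab)
  convert h2 using 1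
  ext j
  cases j using Fin.cases with
  | zero =>
    simp only [expFamily, Fin.cons_zero, Pi.smul_apply', expPoly_zero, map_one]
    exact (mul_one φ).symm
  | succ j => simp [expFamily]

theorem algebraicIndependent_expFamily {r : ℕ} {φ : MeromorphicField}
    (hφ : φ ∈ MeromorphicOrderLTOne) (hφc : ∀ c : ℂ, φ ≠ algebraMap ℂ MeromorphicField c)
    {P : Fin r → Polynomial ℂ} (hP : ∀ j, 1 ≤ (P j).natDegree)
    (hinj : Function.Injective fun j => (P j).natDegree) :
    AlgebraicIndependent ℂ (expFamily φ P) := by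
  have htr : Transcendental ℂ (⟨φ, hφ⟩ : MeromorphicOrderLTOne) :=
    IsAlgClosed.transcendental_of_forall_ne_algebraMap fun c e => hφc c (congrArg Subtype.val e)
  have h1 : AlgebraicIndependent ℂ (fun _ : Unit => (⟨φ, hφ⟩ : MeromorphicOrderLTOne)) :=
    algebraicIndependent_unique_type_iff.2 htr
  -- Transitivity in the tower `ℂ ⊆ MeromorphicOrderLTOne ⊆ MeromorphicField`.
  have h2 := (h1.sumElim_comp (algebraicIndependent_expPoly hP hinj)).comp
    (Fin.cons (Sum.inr ()) Sum.inl : Fin (r + 1) → Fin r ⊕ Unit)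
    (Fin.cons_injective_iff.2 ⟨by simp, Sum.inl_injective⟩)
  convert h2 using 1
  ext j
  cases j using Fin.cases <;> rfl

theorem corollary3p5 (r : ℕ) (φ : MeromorphicField) (hφ : φ ∈ MeromorphicOrderLTOne)
    (hφc : ∀ c : ℂ, φ ≠ algebraMap ℂ MeromorphicField c)
    (P : Fin r → Polynomial ℂ) (hP : ∀ j, 1 ≤ (P j).natDegree)
    (hPP : ∀ j k, j ≠ k → 1 ≤ (P j - P k).natDegree) :
    LinearIndependent ℂ (expFamily φ P) ∧
    (Function.Injective (fun j => (P j).natDegree) →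
      AlgebraicIndependent ℂ (expFamily φ P)) ∧
    ∀ A : Matrix (Fin (r + 1)) (Fin (r + 1)) ℂ, A.det ≠ 0 →
      LinearIndependent ℂ (fun j => ∑ i, A i j • expFamily φ P i) ∧
      (Function.Injective (fun j => (P j).natDegree) →
        AlgebraicIndependent ℂ (fun j => ∑ i, A i j • expFamily φ P i)) := by
  have hφ0 : φ ≠ 0 := fun e => hφc 0 (by rw [e, map_zero])
  have hlin := linearIndependent_expFamily hφ hφ0 hP hPP
  refine ⟨hlin, algebraicIndependent_expFamily hφ hφc hP, fun A hA => ⟨?_, fun hinj =>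
    (algebraicIndependent_expFamily hφ hφc hP hinj).sum_smul_of_det_ne_zero hA⟩⟩
  exact hlin.sum_smul_of_nondegenerate (A := A.transpose)
    (Matrix.nondegenerate_of_det_ne_zero (by rwa [Matrix.det_transpose]))
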